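/- Let $\mathbf H^{n+1}=\{(x,y): x\in\mathbb R^n,\ y>0\}$ be the upper half-space model of the hyperbolic space, with metric $y^{-2}(|dx|^2+dy^2)$, and identify $\mathbb R^n$ with the part $\{y=0\}$ of its ideal boundary $S^n_\infty(\mathbf H^{n+1})=\{y=0\}\cup\{\infty\}$. For a set $A\subset\mathbb R^{n+1}$ and a point $p\in\mathbb R^{n+1}$, the tangent cone $\mathrm{Tan}(A,p)$ is the set of all vectors $w\in\mathbb R^{n+1}$ for which there are points $p_i\in A$ and real numbers $\rho_i>0$ with $p_i\to p$ and $\rho_i(p_i-p)\to w$. **Theorem.** Let $\Sigma^2\subset\mathbf H^{n+1}$ be a minimal surface, that is, an embedded two-dimensional submanifold of class $C^2$ (not assumed to be complete or connected) whose mean curvature vector with respect to the hyperbolic metric vanishes. Suppose that $\Sigma^2$ is asymptotic to an embedded one-dimensional $C^1$ submanifold $\Gamma^1\subset\mathbb R^n$, in the sense that the closure of $\Sigma^2$ in the Euclidean topology of $\mathbb R^{n+1}$ meets $\{y=0\}$ precisely in $\Gamma^1\times\{0\}$; nothing is assumed about the behaviour of $\Sigma^2$ near the ideal point $\infty$. Suppose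 also that the union $\Sigma^2\cup(\Gamma^1\times\{0\})$, equipped with the Euclidean (subspace) topology, is a topological surface with (possibly empty) boundary. Then for every $x\in\Gamma^1$ $$\mathrm{Tan}(\Sigma^2,(x,0))=T_x\Gamma^1\times[0,+\infty).$$ -/

import Mathlib

noncomputable section

/-- `ℝ^{n+1} = ℝⁿ × ℝ` with its Euclidean norm. The last coordinate is the height `y`, the first `n`
coordinates are the point `x ∈ ℝⁿ`. -/
abbrev Ambient (n : ℕ) : Type := EuclideanSpace ℝ (Fin (n + 1))

/-- The height coordinate `y` of a point or vector `(x, y)`. -/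
def height {n : ℕ} (p : Ambient n) : ℝ := p (Fin.last n)

/-- The vertical unit vector `(0, 1)`. -/
def vertical (n : ℕ) : Ambient n := EuclideanSpace.single (Fin.last n) 1

/-- The upper half-space model of the hyperbolic space `H^{n+1}`, as a set: `{(x, y) : y > 0}`. -/
def upperHalf (n : ℕ) : Set (Ambient n) := {p | 0 < height p}

/-- The ideal boundary `{(x, y) : y = 0}` of the half-space (without the ideal point `∞`). -/
def idealBoundary (n : ℕ) : Set (Ambient n) := {p | height p = 0}

/-- The hyperbolic metric `(|dx|² + dy²) / y²` at the point `p`. -/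
def hypMetric {n : ℕ} (p v w : Ambient n) : ℝ := inner ℝ v w / height p ^ 2

/-- The Christoffel bilinear form at `p` of the Levi-Civita connection of `hypMetric`
in the coordinates of the half-space: `∇_v w = D_v w + christoffel p v w`.
See `christoffel_symm` (no torsion) and `christoffel_metric` (compatibility with the metric). -/
def christoffel {n : ℕ} (p v w : Ambient n) : Ambient n :=
  -(height p)⁻¹ • (height v • w + height w • v - (inner ℝ v w : ℝ) • vertical n)

theorem christoffel_symm {n : ℕ} (p v w : Ambient n) :
    christoffel p v w = christoffel p w v := by
  unfold christoffel
  rw [real_inner_comm w v, add_comm (height v • w)]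

theorem christoffel_metric {n : ℕ} (p : Ambient n) (hp : p ∈ upperHalf n) (z v w : Ambient n) :
    HasDerivAt (fun t : ℝ => hypMetric (p + t • z) v w)
      (hypMetric p (christoffel p z v) w + hypMetric p v (christoffel p z w)) 0 := by
  have hp' : height p ≠ 0 := ne_of_gt hp
  have h1 : HasDerivAt (fun t : ℝ => height (p + t • z)) (height z) 0 := by
    simpa [height] using ((hasDerivAt_id (0 : ℝ)).mul_const (height z)).const_add (height p)
  have h2 := (hasDerivAt_const (0 : ℝ) (inner ℝ v w : ℝ)).div (h1.pow 2) (by simpa using hp')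
  have e1 : ∀ u : Ambient n, (inner ℝ u (vertical n) : ℝ) = height u := by
    intro u
    simp [vertical, height, EuclideanSpace.inner_single_right]
  have e2 : ∀ u : Ambient n, (inner ℝ (vertical n) u : ℝ) = height u := by
    intro u
    rw [real_inner_comm, e1]
  refine (h2.congr_deriv ?_)
  simp only [hypMetric, christoffel, inner_smul_left, inner_smul_right, inner_sub_left,
    inner_sub_right, inner_add_left, inner_add_right, e1, e2, real_inner_comm z v]
  simp
  field_simp
  ring

/-- `F`, restricted to the open set `U ⊂ ℝᵐ`, is a local parametrization of class `C^k` of the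
set `S`: an immersion of class `C^k` that is a homeomorphism of `U` onto a relatively open
subset of `S`. -/
structure IsLocalParam {E : Type*} [NormedAddCommGroup E] [NormedSpace ℝ E] (k : ℕ) {m : ℕ}
    (S : Set E) (U : Set (EuclideanSpace ℝ (Fin m))) (F : EuclideanSpace ℝ (Fin m) → E) :
    Prop where
  isOpen : IsOpen U
  contDiffOn : ContDiffOn ℝ k F U
  injective_fderiv : ∀ u ∈ U, Function.Injective (fderiv ℝ F u)
  isEmbedding : Topology.IsEmbedding (U.domRestrict F)
  image_eq : ∃ W : Set E, IsOpen W ∧ F '' U = S ∩ W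

/-- `S` is an embedded `m`-dimensional submanifold (without boundary points of its own)
of class `C^k` of the normed space `E`. -/
def IsSubmanifold {E : Type*} [NormedAddCommGroup E] [NormedSpace ℝ E] (k m : ℕ)
    (S : Set E) : Prop :=
  ∀ p ∈ S, ∃ (U : Set (EuclideanSpace ℝ (Fin m))) (F : EuclideanSpace ℝ (Fin m) → E),
    IsLocalParam k S U F ∧ ∃ u ∈ U, F u = p

/-- The tangent space at `p` of an `m`-dimensional `C^1` submanifold `S`: the image of the
differential of a local parametrization (all of them give the same subspace). -/
def tangentSpaceAt {E : Type*} [NormedAddCommGroup E] [NormedSpace ℝ E] (m : ℕ)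
    (S : Set E) (p : E) : Set E :=
  {w | ∃ (U : Set (EuclideanSpace ℝ (Fin m))) (F : EuclideanSpace ℝ (Fin m) → E),
    IsLocalParam 1 S U F ∧ ∃ u ∈ U, F u = p ∧ w ∈ Set.range (fderiv ℝ F u)}

/-- The coordinate vector field `∂_i F` along a parametrization `F`. -/
def coordField {n m : ℕ} (F : EuclideanSpace ℝ (Fin m) → Ambient n) (i : Fin m)
    (u : EuclideanSpace ℝ (Fin m)) : Ambient n :=
  fderiv ℝ F u (EuclideanSpace.single i 1)

/-- The induced hyperbolic metric `g_ij = g(∂_i F, ∂_j F)` (first fundamental form). -/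
def inducedMetric {n m : ℕ} (F : EuclideanSpace ℝ (Fin m) → Ambient n)
    (u : EuclideanSpace ℝ (Fin m)) : Matrix (Fin m) (Fin m) ℝ :=
  Matrix.of fun i j => hypMetric (F u) (coordField F i u) (coordField F j u)

/-- The hyperbolic covariant derivative `∇_{∂_i F} ∂_j F`. -/
def covDeriv {n m : ℕ} (F : EuclideanSpace ℝ (Fin m) → Ambient n) (i j : Fin m)
    (u : EuclideanSpace ℝ (Fin m)) : Ambient n :=
  fderiv ℝ (coordField F j) u (EuclideanSpace.single i 1)
    + christoffel (F u) (coordField F i u) (coordField F j u)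

/-- The second fundamental form `II(∂_i F, ∂_j F) = (∇_{∂_i F} ∂_j F)^⊥`. The hyperbolic metric is
a pointwise multiple of the Euclidean one, so the normal projections for the two metrics agree. -/
def secondFundForm {n m : ℕ} (F : EuclideanSpace ℝ (Fin m) → Ambient n) (i j : Fin m)
    (u : EuclideanSpace ℝ (Fin m)) : Ambient n :=
  ((LinearMap.range (fderiv ℝ F u).toLinearMap)ᗮ).starProjection (covDeriv F i j u)

/-- The mean curvature vector in hyperbolic space: the trace `∑ g^{ij} II(∂_i F, ∂_j F)`. -/
def meanCurvature {n m : ℕ} (F : EuclideanSpace ℝ (Fin m) → Ambient n)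
    (u : EuclideanSpace ℝ (Fin m)) : Ambient n :=
  ∑ i, ∑ j, ((inducedMetric F u)⁻¹ i j) • secondFundForm F i j u

/-- `S` is a minimal surface in the hyperbolic space: an embedded two-dimensional submanifold of
class `C^2` of the upper half-space whose mean curvature vector vanishes at each point. (The
mean curvature vector at a point does not depend on the local parametrization around it.) -/
def IsMinimalSurface {n : ℕ} (S : Set (Ambient n)) : Prop :=
  S ⊆ upperHalf n ∧
    ∀ p ∈ S, ∃ (U : Set (EuclideanSpace ℝ (Fin 2))) (F : EuclideanSpace ℝ (Fin 2) → Ambient n),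
      IsLocalParam 2 S U F ∧ ∃ u ∈ U, F u = p ∧ meanCurvature F u = 0

/-- `S` is asymptotic to the subset `Γ` of the ideal boundary: the Euclidean closure of `S` meets
the ideal boundary `{y = 0}` precisely in `Γ`. (The ideal point `∞` is not looked at; it may or
may not be a limit of `S`.) -/
def IsAsymptoticTo {n : ℕ} (S Γ : Set (Ambient n)) : Prop :=
  closure S ∩ idealBoundary n = Γ

/-- The set `A`, with the subspace topology, is a topological surface with (possibly empty)
boundary: it is locally homeomorphic to the closed half-plane. -/
def IsTopSurfaceWithBoundary {X : Type*} [TopologicalSpace X] (A : Set X) : Prop :=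
  Nonempty (ChartedSpace (EuclideanHalfSpace 2) A)

/-- The tangent cone `Tan(A, p)`: limits of `ρ_i (p_i - p)` with `p_i ∈ A`, `p_i → p`, `ρ_i > 0`. -/
def tanCone {E : Type*} [NormedAddCommGroup E] [NormedSpace ℝ E] (A : Set E) (p : E) : Set E :=
  {w | ∃ (q : ℕ → E) (ρ : ℕ → ℝ), (∀ i, q i ∈ A) ∧ (∀ i, 0 < ρ i) ∧
    Filter.Tendsto q Filter.atTop (nhds p) ∧
    Filter.Tendsto (fun i => ρ i • (q i - p)) Filter.atTop (nhds w)}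

end

/-! The upper bound on the cone comes from hemispherical barriers. At a critical point, on a minimal
surface, of the squared Euclidean distance to `b`, the trace of half its Hessian equals `2 * height
b / y`. No local minimum is therefore possible when `b` lies below the ideal boundary
(`IsMinimalSurface.height_nonneg_of_isLocalMinOn`). Lowering the centre of a half-ball slightly
turns this into `IsMinimalSurface.disjoint_ball`. A point of the surface near `p` outside a thin
cone around the vertical half-plane over the tangent line would lie in such a half-ball. The
half-ball misses `Γ`, because `Γ` is `C^1`, and it meets the surface in a compact set, because `S ∪
Γ` is locally compact (`IsMinimalSurface.eventually_norm_normalPart_le`). Hence tangent vectors lie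
in the half-plane. The lower bound is topological. Removing `p` from a surface with boundary leaves
small neighbourhoods connected, while `Γ` leaves `p` in both tangent directions. The connected
punctured neighbourhood must cross every hyperplane that separates these two sides. Being squeezed
against the half-plane, it crosses close to the prescribed ray (`mem_tanCone_of_normalPart`).
Horizontal directions follow because the cone is closed. -/

/-! ### The maximum principle and hemispherical barriers. -/

theorem inner_vertical {n : ℕ} (z : Ambient n) : (inner ℝ z (vertical n) : ℝ) = height z := by
  simp [vertical, height, EuclideanSpace.inner_single_right]

theorem norm_vertical (n : ℕ) : ‖vertical n‖ = 1 := by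
  simp [vertical]

/-- The first and second order necessary conditions at a point of a `C^2` map where the distance
to `b` has a local minimum. -/
theorem second_order_of_isLocalMin {V E : Type*} [NormedAddCommGroup V] [NormedSpace ℝ V]
    [NormedAddCommGroup E] [InnerProductSpace ℝ E] {F : V → E} {u : V} {b : E}
    (hF : ContDiffAt ℝ 2 F u) (hmin : IsLocalMin (fun x => ‖F x - b‖ ^ 2) u) (v : V) :
    inner ℝ (F u - b) (fderiv ℝ F u v) = (0 : ℝ) ∧
      0 ≤ inner ℝ (fderiv ℝ F u v) (fderiv ℝ F u v)
        + (inner ℝ (F u - b) (fderiv ℝ (fderiv ℝ F) u v v) : ℝ) := by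
  have hline : ∀ t : ℝ, HasDerivAt (fun t : ℝ => u + t • v) v t := fun t => by
    simpa using ((hasDerivAt_id t).smul_const v).const_add u
  have hlim : Filter.Tendsto (fun t : ℝ => u + t • v) (nhds 0) (nhds u) := by
    simpa using (hline 0).continuousAt.tendsto
  have hd : ∀ᶠ t in nhds (0 : ℝ), HasDerivAt (fun t : ℝ => ‖F (u + t • v) - b‖ ^ 2)
      (2 * inner ℝ (F (u + t • v) - b) (fderiv ℝ F (u + t • v) v)) t := by
    have h1 : ∀ᶠ x in nhds u, DifferentiableAt ℝ F x :=
      (hF.eventually (by simp)).mono fun x hx => hx.differentiableAt (by simp)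
    filter_upwards [hlim.eventually h1] with t ht
    have h2 : HasDerivAt (fun t : ℝ => F (u + t • v)) (fderiv ℝ F (u + t • v) v) t :=
      ht.hasFDerivAt.comp_hasDerivAt t (hline t)
    exact (h2.sub_const b).norm_sq
  have hd2 : HasDerivAt (fun t : ℝ => 2 * (inner ℝ (F (u + t • v) - b)
      (fderiv ℝ F (u + t • v) v) : ℝ))
      (2 * (inner ℝ (F u - b) (fderiv ℝ (fderiv ℝ F) u v v)
        + inner ℝ (fderiv ℝ F u v) (fderiv ℝ F u v))) 0 := by
    have e0 : u + (0 : ℝ) • v = u := by simp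
    have h1 : HasFDerivAt F (fderiv ℝ F u) (u + (0 : ℝ) • v) := by
      rw [e0]; exact (hF.differentiableAt (by simp)).hasFDerivAt
    have h2 : HasFDerivAt (fderiv ℝ F) (fderiv ℝ (fderiv ℝ F) u) (u + (0 : ℝ) • v) := by
      rw [e0]
      exact ((hF.fderiv_right (m := 1) (by norm_num)).differentiableAt (by simp)).hasFDerivAt
    have h3 : HasDerivAt (fun t : ℝ => F (u + t • v) - b) (fderiv ℝ F u v) 0 :=
      (h1.comp_hasDerivAt (0 : ℝ) (hline 0)).sub_const b
    have h4 : HasDerivAt (fun t : ℝ => fderiv ℝ F (u + t • v)) (fderiv ℝ (fderiv ℝ F) u v) 0 :=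
      h2.comp_hasDerivAt (0 : ℝ) (hline 0)
    have h5 : HasDerivAt (fun t : ℝ => fderiv ℝ F (u + t • v) v)
        (fderiv ℝ (fderiv ℝ F) u v v) 0 := by
      simpa using h4.clm_apply (hasDerivAt_const (0 : ℝ) v)
    have h6 := (h3.inner ℝ h5).const_mul 2
    simpa only [e0] using h6
  have hmin' : IsLocalMin (fun t : ℝ => ‖F (u + t • v) - b‖ ^ 2) 0 := by
    have := hlim.eventually hmin
    filter_upwards [this] with t ht
    simpa using ht
  have hderiv : deriv (fun t : ℝ => ‖F (u + t • v) - b‖ ^ 2) =ᶠ[nhds 0]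
      fun t => 2 * (inner ℝ (F (u + t • v) - b) (fderiv ℝ F (u + t • v) v) : ℝ) :=
    hd.mono fun t ht => ht.deriv
  have first : (inner ℝ (F u - b) (fderiv ℝ F u v) : ℝ) = 0 := by
    have := hmin'.hasDerivAt_eq_zero hd.self_of_nhds
    simpa using this
  refine ⟨first, ?_⟩
  -- A negative second derivative would make the minimum also a local maximum. The function would
  -- then be locally constant, with second derivative zero.
  by_contra! hneg
  have hdd : deriv (deriv fun t : ℝ => ‖F (u + t • v) - b‖ ^ 2) 0 < 0 := by
    rw [hderiv.deriv_eq, hd2.deriv]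
    linarith
  have hmax := isLocalMax_of_deriv_deriv_neg hdd
    (by rw [hderiv.self_of_nhds]; simp [first]) hd.self_of_nhds.continuousAt
  have hconst : (fun t : ℝ => ‖F (u + t • v) - b‖ ^ 2) =ᶠ[nhds 0]
      fun _ => ‖F (u + (0 : ℝ) • v) - b‖ ^ 2 := by
    filter_upwards [hmin', hmax] with t h1 h2 using le_antisymm h2 h1
  rw [hconst.deriv.deriv_eq] at hdd
  simp at hdd

theorem IsLocalParam.contDiffAt {E : Type*} [NormedAddCommGroup E] [NormedSpace ℝ E] {k m : ℕ}
    {S : Set E} {U : Set (EuclideanSpace ℝ (Fin m))} {F : EuclideanSpace ℝ (Fin m) → E}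
    (hF : IsLocalParam k S U F) {u : EuclideanSpace ℝ (Fin m)} (hu : u ∈ U) :
    ContDiffAt ℝ k F u :=
  hF.contDiffOn.contDiffAt (hF.isOpen.mem_nhds hu)

theorem IsLocalParam.mapsTo {E : Type*} [NormedAddCommGroup E] [NormedSpace ℝ E] {k m : ℕ}
    {S : Set E} {U : Set (EuclideanSpace ℝ (Fin m))} {F : EuclideanSpace ℝ (Fin m) → E}
    (hF : IsLocalParam k S U F) : Set.MapsTo F U S := by
  obtain ⟨W, -, hW⟩ := hF.image_eq
  intro x hx
  exact (hW ▸ Set.mem_image_of_mem F hx : F x ∈ S ∩ W).1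

/-- The trace of a quadratic form that is nonnegative, with respect to an inner product with Gram
matrix `(a, b; b, c)`. -/
theorem trace_nonneg_of_quadratic_nonneg {a b c h₀₀ h₀₁ h₁₀ h₁₁ : ℝ} (ha : 0 < a)
    (hdet : 0 < a * c - b * b)
    (h : ∀ s t : ℝ, 0 ≤ s * s * h₀₀ + s * t * h₀₁ + t * s * h₁₀ + t * t * h₁₁) :
    0 ≤ c * h₀₀ - b * h₀₁ - b * h₁₀ + a * h₁₁ := by
  have h1 := h 1 0
  -- The vector `(b, -a)` is Gram-orthogonal to `(1, 0)`. Its value plus `(a * c - b * b) * h₀₀` is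
  -- `a` times the trace in the goal.
  have h2 := h b (-a)
  have h3 : 0 ≤ a * (c * h₀₀ - b * h₀₁ - b * h₁₀ + a * h₁₁) := by
    have h0 : 0 ≤ h₀₀ := by simpa using h1
    nlinarith [mul_nonneg hdet.le h0]
  exact nonneg_of_mul_nonneg_right h3 ha

/-- Maximum principle: a minimal surface cannot touch from outside a ball whose centre lies
below the ideal boundary. -/
theorem IsMinimalSurface.height_nonneg_of_isLocalMinOn {n : ℕ} {S : Set (Ambient n)}
    (hS : IsMinimalSurface S) {q b : Ambient n} (hq : q ∈ S)
    (hmin : IsLocalMinOn (fun z => ‖z - b‖ ^ 2) S q) : 0 ≤ height b := by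
  obtain ⟨U, F, hF, u, hu, rfl, hH⟩ := hS.2 q hq
  have hy : 0 < height (F u) := hS.1 hq
  have hFu : ContDiffAt ℝ 2 F u := hF.contDiffAt hu
  have hmin' : IsLocalMin (fun x => ‖F x - b‖ ^ 2) u := by
    have h1 : Filter.Tendsto F (nhds u) (nhdsWithin (F u) S) :=
      tendsto_nhdsWithin_iff.2 ⟨hFu.continuousAt,
        Filter.mem_of_superset (hF.isOpen.mem_nhds hu) fun x hx => hF.mapsTo hx⟩
    exact h1.eventually hmin
  have hsec := second_order_of_isLocalMin hFu hmin'
  set P := F u - b with hP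
  set X : Fin 2 → Ambient n := fun i => coordField F i u with hX
  set A : Fin 2 → Fin 2 → Ambient n := fun i j =>
    fderiv ℝ (fderiv ℝ F) u (EuclideanSpace.single i 1) (EuclideanSpace.single j 1) with hA
  have hAX : ∀ i j, A i j = fderiv ℝ (fderiv ℝ F) u (EuclideanSpace.single i 1)
    (EuclideanSpace.single j 1) := fun i j => rfl
  have hPX : ∀ i, (inner ℝ P (X i) : ℝ) = 0 := fun i => (hsec _).1
  have hAeq : ∀ i j, fderiv ℝ (coordField F j) u (EuclideanSpace.single i 1) = A i j := by
    intro i j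
    have h2 : HasFDerivAt (fderiv ℝ F) (fderiv ℝ (fderiv ℝ F) u) u :=
      ((hFu.fderiv_right (m := 1) (by norm_num)).differentiableAt (by simp)).hasFDerivAt
    have h3 := h2.clm_apply (hasFDerivAt_const (EuclideanSpace.single j (1 : ℝ)) u)
    have h4 : fderiv ℝ (coordField F j) u = _ := h3.fderiv
    rw [h4]
    simp [A]
  have hPperp : P ∈ (LinearMap.range (fderiv ℝ F u).toLinearMap)ᗮ := by
    rw [Submodule.mem_orthogonal']
    rintro _ ⟨v, rfl⟩
    exact (hsec v).1
  set g : Fin 2 → Fin 2 → ℝ := fun i j => inner ℝ (X i) (X j) with hg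
  have hgX : ∀ i j, g i j = inner ℝ (X i) (X j) := fun i j => rfl
  -- Since `P` is normal, the projection drops out and only the vertical Christoffel term survives.
  -- It contributes `g i j * height P / y`, that is, the metric part of the Hessian minus a multiple
  -- of `height b`.
  have hII : ∀ i j, (inner ℝ P (secondFundForm F i j u) : ℝ)
      = (g i j + inner ℝ P (A i j)) - g i j * (height b / height (F u)) := by
    intro i j
    have h1 : (inner ℝ P (secondFundForm F i j u) : ℝ) = inner ℝ P (covDeriv F i j u) := by
      unfold secondFundForm
      rw [← Submodule.inner_starProjection_left_eq_right,
        Submodule.starProjection_eq_self_iff.2 hPperp]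
    have h2 : height P = height (F u) - height b := by simp [hP, height]
    rw [h1]
    unfold covDeriv christoffel
    rw [hAeq]
    simp only [inner_add_right, inner_smul_right, inner_sub_right, inner_vertical, h2]
    have h3 := hPX i
    have h4 := hPX j
    simp only [hX] at h3 h4
    rw [h3, h4]
    simp only [hg, hX]
    field_simp
    ring
  have hlin : ∀ s t : ℝ, fderiv ℝ F u (s • EuclideanSpace.single 0 1
      + t • EuclideanSpace.single 1 1) = s • X 0 + t • X 1 := by
    intro s t
    simp [hX, coordField]
  have hinj : ∀ s t : ℝ, s • X 0 + t • X 1 = 0 → s = 0 ∧ t = 0 := by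
    intro s t hst
    have h1 := hF.injective_fderiv u hu (((hlin s t).trans hst).trans (map_zero _).symm)
    have h2 := congrArg (fun z : EuclideanSpace ℝ (Fin 2) => z 0) h1
    have h3 := congrArg (fun z : EuclideanSpace ℝ (Fin 2) => z 1) h1
    constructor
    · simpa using h2
    · simpa using h3
  have ha : 0 < g 0 0 := by
    refine real_inner_self_pos.2 fun h => ?_
    simpa using (hinj 1 0 (by simp [h])).1
  have hsymm : g 1 0 = g 0 1 := real_inner_comm _ _
  have hdet : 0 < g 0 0 * g 1 1 - g 0 1 * g 0 1 := by
    -- Gram–Schmidt without division: this vector is orthogonal to `X 0`, and its squared length is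
    -- `g 0 0` times the Gram determinant.
    have h1 : 0 < (inner ℝ ((-g 0 1) • X 0 + g 0 0 • X 1) ((-g 0 1) • X 0 + g 0 0 • X 1) : ℝ) :=
      real_inner_self_pos.2 fun h => ha.ne' (hinj _ _ h).2
    have h2 : (inner ℝ ((-g 0 1) • X 0 + g 0 0 • X 1) ((-g 0 1) • X 0 + g 0 0 • X 1) : ℝ)
        = g 0 0 * (g 0 0 * g 1 1 - g 0 1 * g 0 1) := by
      simp only [inner_add_left, inner_add_right, real_inner_smul_left, real_inner_smul_right,
        ← hgX, hsymm]
      ring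
    rw [h2] at h1
    exact pos_of_mul_pos_right h1 ha.le
  have hquad := trace_nonneg_of_quadratic_nonneg ha hdet
    (h₀₀ := g 0 0 + inner ℝ P (A 0 0)) (h₀₁ := g 0 1 + inner ℝ P (A 0 1))
    (h₁₀ := g 1 0 + inner ℝ P (A 1 0)) (h₁₁ := g 1 1 + inner ℝ P (A 1 1)) (by
      intro s t
      have h1 := (hsec (s • EuclideanSpace.single 0 1 + t • EuclideanSpace.single 1 1)).2
      rw [hlin] at h1
      simp only [map_add, map_smul, add_apply, smul_apply, ← hAX, inner_add_left,
        inner_add_right, real_inner_smul_left, real_inner_smul_right, ← hgX] at h1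
      linarith)
  have hH0 : (inner ℝ P (meanCurvature F u) : ℝ) = 0 := by rw [hH, inner_zero_right]
  have hG : inducedMetric F u = !![g 0 0 / height (F u) ^ 2, g 0 1 / height (F u) ^ 2;
      g 0 1 / height (F u) ^ 2, g 1 1 / height (F u) ^ 2] := by
    rw [← hsymm]
    conv_rhs => rw [hsymm]
    ext i j
    fin_cases i <;> fin_cases j
    · rfl
    · rfl
    · change g 1 0 / _ = _
      rw [hsymm]
      rfl
    · rfl
  unfold meanCurvature at hH0
  simp only [Fin.sum_univ_two, inner_add_right, inner_smul_right, hII, hG, Matrix.inv_def,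
    Matrix.det_fin_two_of, Matrix.adjugate_fin_two_of, Matrix.smul_apply, Ring.inverse_eq_inv',
    smul_eq_mul, Matrix.of_apply, Matrix.cons_val', Matrix.cons_val_zero, Matrix.cons_val_one,
    Matrix.cons_val_fin_one, hsymm] at hH0 hquad
  rw [show g 0 0 / height (F u) ^ 2 * (g 1 1 / height (F u) ^ 2)
      - g 0 1 / height (F u) ^ 2 * (g 0 1 / height (F u) ^ 2)
      = (g 0 0 * g 1 1 - g 0 1 * g 0 1) / height (F u) ^ 4 by field_simp] at hH0
  -- This is vanishing mean curvature paired with `P`, cleared of denominators. The factor 2 is the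
  -- trace of the metric, so `height b` inherits the sign of the Hessian trace.
  have key : 2 * height b * (g 0 0 * g 1 1 - g 0 1 * g 0 1) = height (F u) *
      (g 1 1 * (g 0 0 + inner ℝ P (A 0 0)) - g 0 1 * (g 0 1 + inner ℝ P (A 0 1))
        - g 0 1 * (g 0 1 + inner ℝ P (A 1 0)) + g 0 0 * (g 1 1 + inner ℝ P (A 1 1))) := by
    generalize hD : g 0 0 * g 1 1 - g 0 1 * g 0 1 = D at *
    field_simp at hH0
    rw [← hD]
    have h1 := (mul_eq_zero.1 (hH0.trans (mul_zero D))).resolve_left hy.ne'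
    linear_combination (-1 : ℝ) * h1
  have h1 : 0 ≤ 2 * height b * (g 0 0 * g 1 1 - g 0 1 * g 0 1) :=
    key ▸ mul_nonneg hy.le hquad
  linarith [nonneg_of_mul_nonneg_left h1 hdet]

/-- A half-ball centred at the ideal boundary that a minimal surface meets only properly is
missed by the surface. -/
theorem IsMinimalSurface.disjoint_ball {n : ℕ} {S : Set (Ambient n)}
    (hS : IsMinimalSurface S) {a : Ambient n} (ha : height a = 0) {r : ℝ}
    (hc : IsCompact (S ∩ Metric.closedBall a r)) : Disjoint S (Metric.ball a r) := by
  rw [Set.disjoint_left]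
  intro q hq hqa
  rw [mem_ball_iff_norm] at hqa
  have hyq : 0 < height q := hS.1 hq
  have hr : 0 < r := (norm_nonneg _).trans_lt hqa
  have hgap : 0 < r ^ 2 - ‖q - a‖ ^ 2 := by nlinarith [norm_nonneg (q - a)]
  -- The centre is lowered so little that `q` still beats the boundary sphere. The minimiser over
  -- the closed ball then lies in the open ball and is a local minimum on all of `S`.
  obtain ⟨τ, hτ, hτq⟩ : ∃ τ : ℝ, 0 < τ ∧ ‖q - a‖ ^ 2 + 2 * τ * height q < r ^ 2 := by
    refine ⟨(r ^ 2 - ‖q - a‖ ^ 2) / (4 * height q), by positivity, ?_⟩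
    have : 2 * ((r ^ 2 - ‖q - a‖ ^ 2) / (4 * height q)) * height q
        = (r ^ 2 - ‖q - a‖ ^ 2) / 2 := by
      field_simp
      ring
    linarith
  set b := a - τ • vertical n with hb
  have hexp : ∀ z : Ambient n, ‖z - b‖ ^ 2 = ‖z - a‖ ^ 2 + 2 * τ * height z + τ ^ 2 := by
    intro z
    have h1 : z - b = (z - a) + τ • vertical n := by rw [hb]; abel
    have h2 : height (z - a) = height z := by simpa [height] using ha
    rw [h1, norm_add_sq_real, inner_smul_right, inner_vertical, h2, norm_smul, norm_vertical]
    simp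
    ring
  obtain ⟨z, hz, hzmin⟩ := hc.exists_isMinOn ⟨q, hq, by
    rw [mem_closedBall_iff_norm]; exact hqa.le⟩
    (f := fun z => ‖z - b‖ ^ 2) (by fun_prop)
  have hzq : ‖z - b‖ ^ 2 ≤ ‖q - b‖ ^ 2 :=
    hzmin ⟨hq, by rw [mem_closedBall_iff_norm]; exact hqa.le⟩
  have hyz : 0 < height z := hS.1 hz.1
  have hza : z ∈ Metric.ball a r := by
    rw [mem_ball_iff_norm]
    rw [hexp, hexp] at hzq
    have : ‖z - a‖ ^ 2 < r ^ 2 := by nlinarith [mul_pos hτ hyz]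
    exact lt_of_pow_lt_pow_left₀ 2 hr.le this
  have hloc : IsLocalMinOn (fun z => ‖z - b‖ ^ 2) S z := by
    have : Metric.ball a r ∈ nhdsWithin z S :=
      mem_nhdsWithin_of_mem_nhds (Metric.isOpen_ball.mem_nhds hza)
    filter_upwards [this, self_mem_nhdsWithin] with w hw hwS
    exact hzmin ⟨hwS, Metric.ball_subset_closedBall hw⟩
  have h1 := hS.height_nonneg_of_isLocalMinOn hz.1 hloc
  have h2 : height b = -τ := by
    have : height a = 0 := ha
    simp only [height] at this
    simp [hb, height, vertical, this]
  linarith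

/-! ### Local topology of surfaces with boundary. -/

/-- A segment blocked by `c` is replaced by a detour through a third point of `C` off its line. Such
a point exists because a planar set with interior lies in no line. This covers interior and boundary
points of a half-plane chart at once. -/
theorem Convex.isPreconnected_diff_singleton {E : Type*} [NormedAddCommGroup E] [NormedSpace ℝ E]
    (hE : Module.finrank ℝ E = 2) {C : Set E} (hC : Convex ℝ C) (hint : (interior C).Nonempty)
    (c : E) : IsPreconnected (C \ {c}) := by
  have : FiniteDimensional ℝ E := Module.finite_of_finrank_eq_succ hE
  have hseg : ∀ x ∈ C, ∀ y ∈ C, c ∉ segment ℝ x y → segment ℝ x y ⊆ C \ {c} :=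
    fun x hx y hy h z hz => ⟨hC.segment_subset hx hy hz, fun hzc => h (hzc ▸ hz)⟩
  refine isPreconnected_of_forall_pair fun x hx y hy => ?_
  by_cases hc : c ∈ segment ℝ x y
  · obtain ⟨z, hzC, hz⟩ : ∃ z ∈ C, z ∉ line[ℝ, x, y] := by
      by_contra! hall
      have h1 : affineSpan ℝ C = ⊤ :=
        top_unique ((isOpen_interior.affineSpan_eq_top hint).ge.trans
          (affineSpan_mono ℝ interior_subset))
      have h2 : line[ℝ, x, y] = ⊤ := top_unique (h1.ge.trans (affineSpan_le.2 hall))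
      have h3 := collinear_iff_finrank_le_one.1 (collinear_pair ℝ x y)
      rw [← direction_affineSpan, h2, AffineSubspace.direction_top, finrank_top, hE] at h3
      norm_num at h3
    have hcl : c ∈ line[ℝ, x, y] := (mem_segment_iff_wbtw.1 hc).mem_affineSpan
    -- If `c ≠ x` were on this segment, `z` would lie on the line through `x` and `c`, which is the
    -- line through `x` and `y`.
    have hxz : c ∉ segment ℝ x z := fun h => hz <|
      affineSpan_pair_le_of_mem_of_mem (left_mem_affineSpan_pair ℝ x y) hcl
        ((mem_segment_iff_wbtw.1 h).right_mem_affineSpan_of_left_ne fun h => hx.2 h)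
    have hyz : c ∉ segment ℝ y z := fun h => hz <|
      affineSpan_pair_le_of_mem_of_mem (right_mem_affineSpan_pair ℝ x y) hcl
        ((mem_segment_iff_wbtw.1 h).right_mem_affineSpan_of_left_ne fun h => hy.2 h)
    exact ⟨segment ℝ x z ∪ segment ℝ y z,
      Set.union_subset (hseg x hx.1 z hzC hxz) (hseg y hy.1 z hzC hyz),
      Or.inl (left_mem_segment ℝ x z), Or.inr (left_mem_segment ℝ y z),
      (convex_segment x z).isPreconnected.union z (right_mem_segment ℝ x z)
        (right_mem_segment ℝ y z) (convex_segment y z).isPreconnected⟩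
  · exact ⟨segment ℝ x y, hseg x hx.1 y hy.1 hc, left_mem_segment ℝ x y, right_mem_segment ℝ x y,
      (convex_segment x y).isPreconnected⟩

open scoped Manifold in
/-- Points of a surface with boundary have arbitrarily small neighbourhoods that stay connected
when the point is removed. -/
theorem IsTopSurfaceWithBoundary.exists_isPreconnected_diff_singleton {X : Type*}
    [TopologicalSpace X] {A : Set X} (hA : IsTopSurfaceWithBoundary A) {p : X} (hp : p ∈ A)
    {O : Set X} (hO : O ∈ nhds p) :
    ∃ V ∈ nhdsWithin p A, V ⊆ O ∩ A ∧ IsPreconnected (V \ {p}) := by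
  obtain ⟨hch⟩ := hA
  set x : A := ⟨p, hp⟩ with hx
  set φ := extChartAt (𝓡∂ 2) x with hφ
  have hO' : ((↑) : A → X) ⁻¹' O ∈ nhds x := continuous_subtype_val.continuousAt hO
  have hpre : φ.symm ⁻¹' ((↑) ⁻¹' O) ∩ φ.target ∈
      nhdsWithin (φ x) (Set.range (𝓡∂ 2)) := by
    refine Filter.inter_mem ?_ (extChartAt_target_mem_nhdsWithin x)
    have h1 := (map_extChartAt_symm_nhdsWithin_range (I := 𝓡∂ 2) x).le hO'
    exact h1
  obtain ⟨r, hr, hball⟩ := Metric.mem_nhdsWithin_iff.1 hpre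
  set C := Metric.ball (φ x) r ∩ Set.range (𝓡∂ 2) with hC
  have hCconv : Convex ℝ C := (convex_ball _ _).inter (𝓡∂ 2).convex_range
  have hφx : φ x ∈ C := ⟨Metric.mem_ball_self hr, by simp [hφ, extChartAt]⟩
  have hint : (interior C).Nonempty := by
    have h1 : φ x ∈ closure (interior (Set.range (𝓡∂ 2))) :=
      (𝓡∂ 2).range_subset_closure_interior hφx.2
    rw [hC, interior_inter, Metric.isOpen_ball.interior_eq]
    exact mem_closure_iff.1 h1 _ Metric.isOpen_ball hφx.1
  have hpc : IsPreconnected (C \ {φ x}) :=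
    hCconv.isPreconnected_diff_singleton (by simp) hint _
  have hCt : C ⊆ φ.target := fun z hz => (hball hz).2
  have hcont : ContinuousOn (fun z => (φ.symm z : X)) (C \ {φ x}) :=
    continuous_subtype_val.comp_continuousOn
      ((continuousOn_extChartAt_symm x).mono (Set.sdiff_subset.trans hCt))
  refine ⟨(fun z => (φ.symm z : X)) '' C, ?_, ?_, ?_⟩
  · rw [← map_nhds_subtype_val x, Filter.mem_map,
      ← map_extChartAt_symm_nhdsWithin_range (I := 𝓡∂ 2) x, Filter.mem_map]
    have : C ∈ nhdsWithin (φ x) (Set.range (𝓡∂ 2)) :=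
      Filter.inter_mem (mem_nhdsWithin_of_mem_nhds (Metric.ball_mem_nhds _ hr)) self_mem_nhdsWithin
    exact Filter.mem_of_superset this fun z hz => ⟨z, hz, rfl⟩
  · rintro _ ⟨z, hz, rfl⟩
    exact ⟨(hball hz).1, (φ.symm z).2⟩
  · convert hpc.image _ hcont using 1
    ext w
    constructor
    · rintro ⟨⟨z, hz, rfl⟩, hne⟩
      refine ⟨z, ⟨hz, fun h => hne ?_⟩, rfl⟩
      rw [Set.mem_singleton_iff] at h ⊢
      rw [h]
      exact congrArg Subtype.val (extChartAt_to_inv (I := 𝓡∂ 2) x)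
    · rintro ⟨z, ⟨hz, hne⟩, rfl⟩
      refine ⟨⟨z, hz, rfl⟩, fun h => hne ?_⟩
      have h1 : φ.symm z = x := Subtype.ext h
      rw [Set.mem_singleton_iff, ← h1, φ.right_inv (hCt hz)]

/-- Near each of its points a surface with boundary is contained in a compact part of itself. -/
theorem IsTopSurfaceWithBoundary.exists_isCompact {X : Type*} [TopologicalSpace X] {A : Set X}
    (hA : IsTopSurfaceWithBoundary A) {p : X} (hp : p ∈ A) :
    ∃ K ⊆ A, IsCompact K ∧ K ∈ nhdsWithin p A := by
  obtain ⟨hch⟩ := hA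
  have hH : LocallyCompactSpace (EuclideanHalfSpace 2) :=
    (isClosed_le continuous_const (by fun_prop :
      Continuous fun z : EuclideanSpace ℝ (Fin 2) => z 0)).isClosedEmbedding_subtypeVal.locallyCompactSpace
  have := ChartedSpace.locallyCompactSpace (EuclideanHalfSpace 2) A
  obtain ⟨K, hK, hKx⟩ := exists_compact_mem_nhds (⟨p, hp⟩ : A)
  refine ⟨(↑) '' K, by rintro _ ⟨z, -, rfl⟩; exact z.2, hK.image continuous_subtype_val, ?_⟩
  rw [← map_nhds_subtype_val ⟨p, hp⟩]
  exact Filter.image_mem_map hKx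

/-! ### Distance to the vertical plane over the tangent line. -/

/-- The component of `z` orthogonal to the horizontal unit vector `e` and to the vertical. -/
noncomputable def normalPart {n : ℕ} (e z : Ambient n) : Ambient n :=
  z - (inner ℝ e z : ℝ) • e - height z • vertical n

section normalPart

variable {n : ℕ} {e : Ambient n}

theorem continuous_height : Continuous (height : Ambient n → ℝ) := by
  unfold height
  fun_prop

theorem height_add (z w : Ambient n) : height (z + w) = height z + height w := rfl

theorem height_sub (z w : Ambient n) : height (z - w) = height z - height w := rfl

theorem height_smul (c : ℝ) (z : Ambient n) : height (c • z) = c * height z := rfl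

theorem height_vertical : height (vertical n) = 1 := by simp [height, vertical]

theorem inner_vertical_left (z : Ambient n) : (inner ℝ (vertical n) z : ℝ) = height z := by
  rw [real_inner_comm, inner_vertical]

theorem continuous_normalPart : Continuous (normalPart e) := by
  unfold normalPart
  have := continuous_height (n := n)
  fun_prop

theorem normalPart_add (z w : Ambient n) :
    normalPart e (z + w) = normalPart e z + normalPart e w := by
  simp only [normalPart, inner_add_right, height_add, add_smul]
  abel

theorem normalPart_smul (c : ℝ) (z : Ambient n) :
    normalPart e (c • z) = c • normalPart e z := by
  simp only [normalPart, inner_smul_right, height_smul, smul_sub, smul_smul]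

theorem normalPart_self (he : ‖e‖ = 1) (he0 : height e = 0) : normalPart e e = 0 := by
  simp [normalPart, he, he0]

theorem inner_normalPart_left (he : ‖e‖ = 1) (he0 : height e = 0) (z w : Ambient n) :
    (inner ℝ (normalPart e z) (normalPart e w) : ℝ) = inner ℝ z (normalPart e w) := by
  have h1 : (inner ℝ e (normalPart e w) : ℝ) = 0 := by
    simp [normalPart, inner_sub_right, inner_smul_right, inner_vertical, he, he0]
  have h2 : (inner ℝ (vertical n) (normalPart e w) : ℝ) = 0 := by
    rw [inner_vertical_left]
    simp [normalPart, height_sub, height_smul, he0, height_vertical]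
  conv_lhs => rw [normalPart]
  simp [inner_sub_left, real_inner_smul_left, h1, h2]

theorem norm_normalPart_le (he : ‖e‖ = 1) (he0 : height e = 0) (z : Ambient n) :
    ‖normalPart e z‖ ≤ ‖z‖ := by
  have h1 := inner_normalPart_left he he0 z z
  have h2 := real_inner_le_norm z (normalPart e z)
  rw [← h1, real_inner_self_eq_norm_sq] at h2
  rcases (norm_nonneg (normalPart e z)).eq_or_lt with h | h
  · rw [← h]; exact norm_nonneg z
  · nlinarith

theorem height_normalPart (he0 : height e = 0) (z : Ambient n) : height (normalPart e z) = 0 := by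
  simp [normalPart, height_sub, height_smul, he0, height_vertical]

theorem eq_add_normalPart (e z : Ambient n) :
    z = (inner ℝ e z : ℝ) • e + height z • vertical n + normalPart e z := by
  simp only [normalPart]
  abel

end normalPart

/-! ### Cone estimates for the boundary curve and for the surface. -/

/-- A `C^1` curve is contained in arbitrarily thin cones around its tangent line. -/
theorem IsLocalParam.eventually_norm_normalPart_le {n : ℕ} {Γ : Set (Ambient n)}
    {U : Set (EuclideanSpace ℝ (Fin 1))} {F : EuclideanSpace ℝ (Fin 1) → Ambient n}
    (hF : IsLocalParam 1 Γ U F) {u : EuclideanSpace ℝ (Fin 1)} (hu : u ∈ U) {e : Ambient n}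
    (he : ‖e‖ = 1) (he0 : height e = 0) (hdF : ∀ h, normalPart e (fderiv ℝ F u h) = 0)
    {ε : ℝ} (hε : 0 < ε) :
    ∀ᶠ z in nhdsWithin (F u) Γ, ‖normalPart e (z - F u)‖ ≤ ε * ‖z - F u‖ := by
  have hdiff : HasFDerivAt F (fderiv ℝ F u) u :=
    ((hF.contDiffAt hu).differentiableAt (by simp)).hasFDerivAt
  obtain ⟨K, hK, hanti⟩ := ((fderiv ℝ F u).toLinearMap.injective_iff_antilipschitz).1
    (hF.injective_fderiv u hu)
  have hKl : ∀ h, ‖h‖ ≤ K * ‖fderiv ℝ F u h‖ := fun h => by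
    simpa using hanti.le_mul_dist h 0
  have hK' : (0 : ℝ) < K := hK
  -- The second bound lets the differentiability error be absorbed, giving `‖x - u‖ ≤ 2 * K * ‖F x -
  -- F u‖`. The first then yields the factor `ε`.
  set η : ℝ := min (ε / (2 * K)) (1 / (2 * K)) with hη
  have hη0 : 0 < η := by positivity
  have hη1 : 2 * (K * η) ≤ ε := by
    have := mul_le_mul_of_nonneg_left (min_le_left (ε / (2 * K)) (1 / (2 * K)))
      (by positivity : (0 : ℝ) ≤ 2 * K)
    rw [mul_div_cancel₀ _ (by positivity)] at this
    linarith
  have hη2 : 2 * (K * η) ≤ 1 := by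
    have := mul_le_mul_of_nonneg_left (min_le_right (ε / (2 * K)) (1 / (2 * K)))
      (by positivity : (0 : ℝ) ≤ 2 * K)
    rw [mul_div_cancel₀ _ (by positivity)] at this
    linarith
  have hsmall : ∀ᶠ x in nhds u, ‖normalPart e (F x - F u)‖ ≤ ε * ‖F x - F u‖ := by
    filter_upwards [hdiff.isLittleO.def hη0] with x hx
    have h1 : F x - F u = (F x - F u - fderiv ℝ F u (x - u)) + fderiv ℝ F u (x - u) := by abel
    have h2 : ‖normalPart e (F x - F u)‖ ≤ η * ‖x - u‖ := by
      rw [h1, normalPart_add, hdF, add_zero]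
      exact (norm_normalPart_le he he0 _).trans hx
    have h3 := hKl (x - u)
    have h4 : ‖fderiv ℝ F u (x - u)‖ ≤ ‖F x - F u‖ + η * ‖x - u‖ := by
      have := norm_sub_le (F x - F u) (F x - F u - fderiv ℝ F u (x - u))
      rw [sub_sub_cancel] at this
      linarith
    have h5 : ‖x - u‖ ≤ 2 * K * ‖F x - F u‖ := by
      have h6 := mul_le_mul_of_nonneg_left h4 hK'.le
      nlinarith [mul_le_mul_of_nonneg_right hη2 (norm_nonneg (x - u))]
    calc _ ≤ η * ‖x - u‖ := h2
      _ ≤ η * (2 * K * ‖F x - F u‖) := by gcongr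
      _ = 2 * (K * η) * ‖F x - F u‖ := by ring
      _ ≤ _ := by gcongr
  obtain ⟨W, hWo, hW⟩ := hF.image_eq
  -- The embedding has relatively open image, so no other piece of `Γ` accumulates at `F u`.
  have hmap : nhdsWithin (F u) Γ = Filter.map F (nhds u) := by
    have h1 := hF.isEmbedding.map_nhds_eq ⟨u, hu⟩
    have hrange : Set.range (U.domRestrict F) = Γ ∩ W := by
      rw [← hW]; exact Set.range_domRestrict F U
    have hFW : F u ∈ W := (hW ▸ Set.mem_image_of_mem F hu : F u ∈ Γ ∩ W).2
    rw [hrange] at h1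
    have h2 : nhdsWithin (F u) (Γ ∩ W) = nhdsWithin (F u) Γ :=
      nhdsWithin_inter_of_mem' (mem_nhdsWithin_of_mem_nhds (hWo.mem_nhds hFW))
    rw [← h2]
    refine h1.symm.trans ?_
    change Filter.map (F ∘ ((↑) : U → _)) _ = _
    rw [← Filter.map_map, map_nhds_subtype_val, hF.isOpen.nhdsWithin_eq hu]
  rw [hmap]
  exact hsmall

/-- Barrier estimate: near an ideal boundary curve contained in thin cones around its tangent line,
a minimal surface that is locally proper is contained in thin cones around the vertical half-plane
over the tangent line. -/
theorem IsMinimalSurface.eventually_norm_normalPart_le {n : ℕ} {S Γ : Set (Ambient n)}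
    (hS : IsMinimalSurface S) {K : Set (Ambient n)} {p e : Ambient n} (hp0 : height p = 0)
    (he : ‖e‖ = 1) (he0 : height e = 0) (hK : IsCompact K) (hKS : K ⊆ S ∪ Γ)
    (hKp : K ∈ nhdsWithin p (S ∪ Γ))
    (hΓ : ∀ ε > 0, ∀ᶠ z in nhdsWithin p Γ, ‖normalPart e (z - p)‖ ≤ ε * ‖z - p‖)
    {c : ℝ} (hc : 0 < c) :
    ∀ᶠ q in nhdsWithin p S, ‖normalPart e (q - p)‖ ≤ c * ‖q - p‖ := by
  -- Chosen so that the barrier ball built below stays within distance `C * d` of `p`: the summands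
  -- come from `2 * ‖q - p‖ ≤ 2 * d / c` and `s + r = 2 * d / c ^ 2 + d / 2`.
  set C : ℝ := 2 / c + 2 / c ^ 2 + 1 / 2 with hC
  have hC0 : 0 < C := by positivity
  obtain ⟨δ₁, hδ₁, h1⟩ := Metric.mem_nhdsWithin_iff.1 hKp
  obtain ⟨δ₂, hδ₂, h2⟩ := Metric.mem_nhdsWithin_iff.1 (hΓ (1 / (4 * C)) (by positivity))
  set δ := min δ₁ δ₂ with hδ
  have hδ0 : 0 < δ := lt_min hδ₁ hδ₂
  refine Metric.mem_nhdsWithin_iff.2 ⟨δ / C, by positivity, ?_⟩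
  rintro q ⟨hqp, hqS⟩
  rw [mem_ball_iff_norm] at hqp
  change ‖normalPart e (q - p)‖ ≤ c * ‖q - p‖
  by_contra! hlt
  set d := ‖normalPart e (q - p)‖ with hd
  have hd0 : 0 < d := (by positivity : 0 ≤ c * ‖q - p‖).trans_lt hlt
  have hdq : d ≤ ‖q - p‖ := norm_normalPart_le he he0 _
  have hqd : ‖q - p‖ ≤ d / c := by rw [le_div_iff₀ hc]; linarith
  have hyq : 0 < height q := hS.1 hqS
  have hy : height q ≤ ‖q - p‖ := by
    have h3 := real_inner_le_norm (q - p) (vertical n)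
    rw [inner_vertical, norm_vertical, height_sub, hp0] at h3
    linarith
  set w : Ambient n := d⁻¹ • normalPart e (q - p) with hw
  have hwn : ‖w‖ = 1 := by
    rw [hw, norm_smul, norm_inv, Real.norm_of_nonneg hd0.le, ← hd, inv_mul_cancel₀ hd0.ne']
  have hqw : (inner ℝ (q - p) w : ℝ) = d := by
    rw [hw, inner_smul_right, ← inner_normalPart_left he he0, real_inner_self_eq_norm_sq, ← hd]
    field_simp
  have hw0 : height w = 0 := by rw [hw, height_smul, height_normalPart he0, mul_zero]
  have hNw : ∀ z : Ambient n, (inner ℝ z w : ℝ) ≤ ‖normalPart e z‖ := by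
    intro z
    have h3 : (inner ℝ z w : ℝ) = inner ℝ (normalPart e z) w := by
      rw [hw, inner_smul_right, inner_smul_right, inner_normalPart_left he he0]
    have h4 := real_inner_le_norm (normalPart e z) w
    rwa [hwn, mul_one, ← h3] at h4
  -- The centre is the foot of `q` pushed outwards by `s` along `w`, and the radius `s + d / 2`
  -- keeps the ball at distance at least `d / 2` from the plane. As `height q ≤ d / c`, one has
  -- `height q ^ 2 ≤ s * d`, so `height q ^ 2 + s ^ 2 < r ^ 2` and the ball contains `q`.
  set s := d / c ^ 2 with hs
  have hs0 : 0 < s := by positivity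
  set r := s + d / 2 with hr
  have hr0 : 0 < r := by positivity
  set a : Ambient n := q - height q • vertical n + s • w with ha
  have ha0 : height a = 0 := by
    rw [ha, height_add, height_sub, height_smul, height_smul, height_vertical, hw0]
    ring
  have hqa : q ∈ Metric.ball a r := by
    rw [mem_ball_iff_norm]
    have h3 : q - a = height q • vertical n - s • w := by rw [ha]; abel
    have h4 : ‖q - a‖ ^ 2 = height q ^ 2 + s ^ 2 := by
      rw [h3, norm_sub_sq_real, inner_smul_right, real_inner_smul_left, inner_vertical_left, hw0,
        norm_smul, norm_smul, norm_vertical, hwn]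
      simp
    have h5 : height q ^ 2 ≤ s * d := by
      have h6 : height q ^ 2 ≤ (d / c) ^ 2 := pow_le_pow_left₀ hyq.le (hy.trans hqd) 2
      have h7 : (d / c) ^ 2 = s * d := by rw [hs]; field_simp
      linarith
    refine lt_of_pow_lt_pow_left₀ 2 hr0.le ?_
    rw [h4, hr]
    nlinarith
  have hap : ‖a - p‖ ≤ 2 * ‖q - p‖ + s := by
    have h3 : a - p = (q - p) - height q • vertical n + s • w := by rw [ha]; abel
    rw [h3]
    have h4 := norm_add_le ((q - p) - height q • vertical n) (s • w)
    have h5 := norm_sub_le (q - p) (height q • vertical n)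
    rw [norm_smul, norm_vertical, Real.norm_of_nonneg hyq.le] at h5
    rw [norm_smul, hwn, Real.norm_of_nonneg hs0.le] at h4
    linarith
  have hz1 : ∀ z ∈ Metric.closedBall a r, ‖z - p‖ ≤ C * d := by
    intro z hz
    rw [mem_closedBall_iff_norm] at hz
    have h3 := norm_add_le (z - a) (a - p)
    rw [sub_add_sub_cancel] at h3
    have h4 : C * d = 2 * (d / c) + s + r := by rw [hC, hr, hs]; ring
    linarith
  have hCd : C * d < δ := by
    have h3 := hdq.trans_lt hqp
    rwa [lt_div_iff₀ hC0, mul_comm] at h3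
  have hz2 : ∀ z ∈ Metric.closedBall a r, d / 2 ≤ inner ℝ (z - p) w := by
    intro z hz
    rw [mem_closedBall_iff_norm] at hz
    have h3 : z - p = (z - a) + ((q - p) - height q • vertical n + s • w) := by rw [ha]; abel
    have h4 : -r ≤ inner ℝ (z - a) w := by
      have h5 := neg_le_of_abs_le (abs_real_inner_le_norm (z - a) w)
      rw [hwn, mul_one] at h5
      linarith
    rw [h3, inner_add_left, inner_add_left, inner_sub_left (q - p), hqw, real_inner_smul_left,
      real_inner_smul_left, inner_vertical_left, hw0, real_inner_self_eq_norm_sq, hwn]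
    linarith
  -- With slope `1 / (4 * C)`, points of `Γ` within `C * d` of `p` have normal part at most `d / 4`,
  -- whereas in the ball it is at least `d / 2`.
  have hdis : ∀ z ∈ Metric.closedBall a r, z ∉ Γ := by
    intro z hz hzΓ
    have h3 : ‖normalPart e (z - p)‖ ≤ 1 / (4 * C) * ‖z - p‖ := h2 ⟨by
      rw [mem_ball_iff_norm]
      exact (hz1 z hz).trans_lt (hCd.trans_le (min_le_right _ _)), hzΓ⟩
    have h4 : 1 / (4 * C) * ‖z - p‖ ≤ 1 / (4 * C) * (C * d) := by
      gcongr
      exact hz1 z hz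
    have h5 : 1 / (4 * C) * (C * d) = d / 4 := by field_simp
    linarith [hNw (z - p), hz2 z hz]
  have hcomp : IsCompact (S ∩ Metric.closedBall a r) := by
    have h3 : S ∩ Metric.closedBall a r = K ∩ Metric.closedBall a r := by
      ext z
      constructor
      · rintro ⟨hzS, hz⟩
        refine ⟨h1 ⟨?_, Or.inl hzS⟩, hz⟩
        rw [mem_ball_iff_norm]
        exact (hz1 z hz).trans_lt (hCd.trans_le (min_le_left _ _))
      · rintro ⟨hzK, hz⟩
        exact ⟨(hKS hzK).resolve_right (hdis z hz), hz⟩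
    rw [h3]
    exact hK.inter_right Metric.isClosed_closedBall
  exact Set.disjoint_left.1 (hS.disjoint_ball ha0 hcomp) hqS hqa

/-! ### The tangent cone. -/

theorem mem_tanCone_iff {E : Type*} [NormedAddCommGroup E] [NormedSpace ℝ E] {A : Set E}
    {p w : E} : w ∈ tanCone A p ↔
      ∀ ε > 0, ∃ q ∈ A, ∃ ρ : ℝ, 0 < ρ ∧ ‖q - p‖ < ε ∧ ‖ρ • (q - p) - w‖ < ε := by
  constructor
  · rintro ⟨q, ρ, hq, hρ, hqp, hw⟩ ε hε
    obtain ⟨i, hi1, hi2⟩ := ((Metric.tendsto_nhds.1 hqp ε hε).and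
      (Metric.tendsto_nhds.1 hw ε hε)).exists
    rw [dist_eq_norm] at hi1 hi2
    exact ⟨q i, hq i, ρ i, hρ i, hi1, hi2⟩
  · intro h
    choose q hq ρ hρ hqp hw using fun i : ℕ => h (1 / ((i : ℝ) + 1)) (by positivity)
    have h0 := tendsto_one_div_add_atTop_nhds_zero_nat (𝕜 := ℝ)
    refine ⟨q, ρ, hq, hρ, ?_, ?_⟩ <;> rw [tendsto_iff_norm_sub_tendsto_zero]
    · exact squeeze_zero (fun _ => norm_nonneg _) (fun i => (hqp i).le) h0
    · exact squeeze_zero (fun _ => norm_nonneg _) (fun i => (hw i).le) h0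

/-- The unit tangent vector of a `C^1` curve in the ideal boundary: it spans the image of the
differential of a parametrization, and the curve continues to both of its sides. -/
theorem IsLocalParam.exists_unit_tangent {n : ℕ} {Γ : Set (Ambient n)}
    {U : Set (EuclideanSpace ℝ (Fin 1))} {F : EuclideanSpace ℝ (Fin 1) → Ambient n}
    (hF : IsLocalParam 1 Γ U F) {u : EuclideanSpace ℝ (Fin 1)} (hu : u ∈ U)
    (hΓ : Γ ⊆ idealBoundary n) :
    ∃ e : Ambient n, ‖e‖ = 1 ∧ height e = 0 ∧
      (∀ v, v ∈ Set.range (fderiv ℝ F u) ↔ ∃ s : ℝ, v = s • e) ∧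
      (∃ᶠ z in nhdsWithin (F u) Γ, 0 < (inner ℝ e (z - F u) : ℝ)) ∧
      ∃ᶠ z in nhdsWithin (F u) Γ, (inner ℝ e (z - F u) : ℝ) < 0 := by
  set x₀ : EuclideanSpace ℝ (Fin 1) := EuclideanSpace.single 0 1 with hx₀
  have hspan : ∀ h : EuclideanSpace ℝ (Fin 1), h = h 0 • x₀ := by
    intro h
    ext i
    fin_cases i
    simp [hx₀]
  set τ := fderiv ℝ F u x₀ with hτ
  have hτ0 : τ ≠ 0 := by
    intro h
    have h1 := hF.injective_fderiv u hu (h.trans (map_zero _).symm)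
    have h2 := congrArg (fun z : EuclideanSpace ℝ (Fin 1) => z 0) h1
    simp [hx₀] at h2
  have hτn : 0 < ‖τ‖ := norm_pos_iff.2 hτ0
  have hdiff : HasFDerivAt F (fderiv ℝ F u) u :=
    ((hF.contDiffAt hu).differentiableAt (by simp)).hasFDerivAt
  have hline : HasDerivAt (fun t : ℝ => F (u + t • x₀)) τ 0 := by
    have h1 : HasDerivAt (fun t : ℝ => u + t • x₀) x₀ 0 := by
      simpa using ((hasDerivAt_id (0 : ℝ)).smul_const x₀).const_add u
    have h2 : HasFDerivAt F (fderiv ℝ F u) (u + (0 : ℝ) • x₀) := by simpa using hdiff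
    exact h2.comp_hasDerivAt (0 : ℝ) h1
  have hlineU : ∀ᶠ t in nhds (0 : ℝ), u + t • x₀ ∈ U := by
    have h1 : ContinuousAt (fun t : ℝ => u + t • x₀) 0 := by fun_prop
    exact h1 (by simpa using hF.isOpen.mem_nhds hu)
  have hlineΓ : Filter.Tendsto (fun t : ℝ => F (u + t • x₀)) (nhds 0) (nhdsWithin (F u) Γ) :=
    tendsto_nhdsWithin_iff.2 ⟨by simpa using hline.continuousAt.tendsto,
      hlineU.mono fun t ht => hF.mapsTo ht⟩
  -- The height vanishes identically along the curve, hence so does its derivative.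
  have hτh : height τ = 0 := by
    have h1 : HasDerivAt (fun t : ℝ => (inner ℝ (F (u + t • x₀)) (vertical n) : ℝ))
        (height τ) 0 := by
      simpa [inner_vertical] using hline.inner ℝ (hasDerivAt_const (0 : ℝ) (vertical n))
    have h2 : (fun t : ℝ => (inner ℝ (F (u + t • x₀)) (vertical n) : ℝ)) =ᶠ[nhds 0]
        fun _ => 0 := by
      filter_upwards [hlineU] with t ht
      rw [inner_vertical]
      exact hΓ (hF.mapsTo ht)
    exact h1.unique ((hasDerivAt_const (0 : ℝ) (0 : ℝ)).congr_of_eventuallyEq h2)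
  set e := ‖τ‖⁻¹ • τ with he
  have hτe : τ = ‖τ‖ • e := by rw [he, smul_smul, mul_inv_cancel₀ hτn.ne', one_smul]
  have hen : ‖e‖ = 1 := by
    rw [he, norm_smul, norm_inv, norm_norm, inv_mul_cancel₀ hτn.ne']
  have hsl : ∀ᶠ t in nhdsWithin (0 : ℝ) {0}ᶜ,
      0 < t⁻¹ * (inner ℝ e (F (u + t • x₀) - F u) : ℝ) := by
    have h1 : HasDerivAt (fun t : ℝ => (inner ℝ e (F (u + t • x₀)) : ℝ)) ‖τ‖ 0 := by
      have h2 := (hasDerivAt_const (0 : ℝ) e).inner ℝ hline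
      have h3 : (inner ℝ e τ : ℝ) = ‖τ‖ := by
        rw [hτe, inner_smul_right, real_inner_self_eq_norm_sq, hen, ← hτe]
        simp
      simpa [h3] using h2
    have h2 := (hasDerivAt_iff_tendsto_slope.1 h1).eventually (lt_mem_nhds hτn)
    filter_upwards [h2] with t ht
    simpa [slope_def_module, inner_sub_right] using ht
  refine ⟨e, hen, ?_, ?_, ?_, ?_⟩
  · rw [he, height_smul, hτh, mul_zero]
  · intro v
    constructor
    · rintro ⟨h, rfl⟩
      refine ⟨h 0 * ‖τ‖, ?_⟩
      rw [mul_smul, ← hτe]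
      conv_lhs => rw [hspan h, map_smul]
    · rintro ⟨s, rfl⟩
      exact ⟨(s * ‖τ‖⁻¹) • x₀, by rw [map_smul, mul_smul]⟩
  · have h1 : ∀ᶠ t in nhdsWithin (0 : ℝ) (Set.Ioi 0),
        0 < (inner ℝ e (F (u + t • x₀) - F u) : ℝ) := by
      have h2 := hsl.filter_mono (nhdsWithin_mono 0 fun t (ht : (0 : ℝ) < t) => ht.ne')
      filter_upwards [h2, self_mem_nhdsWithin] with t ht ht0
      exact (pos_iff_pos_of_mul_pos ht).1 (inv_pos.2 ht0)
    exact (hlineΓ.mono_left nhdsWithin_le_nhds).frequently h1.frequently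
  · have h1 : ∀ᶠ t in nhdsWithin (0 : ℝ) (Set.Iio 0),
        (inner ℝ e (F (u + t • x₀) - F u) : ℝ) < 0 := by
      have h2 := hsl.filter_mono (nhdsWithin_mono 0 fun t (ht : t < (0 : ℝ)) => ht.ne)
      filter_upwards [h2, self_mem_nhdsWithin] with t ht ht0
      exact (neg_iff_neg_of_mul_pos ht).1 (inv_lt_zero.2 ht0)
    exact (hlineΓ.mono_left nhdsWithin_le_nhds).frequently h1.frequently

section cone

variable {n : ℕ} {S Γ : Set (Ambient n)} {p e : Ambient n}

/-- The cone estimate is homogeneous, so it survives rescaling and passes to the limit for every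
`c`; this kills the normal part of `w`. Positivity of heights passes to the limit as a weak
inequality. -/
theorem tanCone_subset_of_normalPart (hS : S ⊆ upperHalf n) (hp0 : height p = 0)
    (hN : ∀ c > 0, ∀ᶠ q in nhdsWithin p S, ‖normalPart e (q - p)‖ ≤ c * ‖q - p‖)
    {w : Ambient n} (hw : w ∈ tanCone S p) :
    ∃ s t : ℝ, 0 ≤ t ∧ w = s • e + t • vertical n := by
  obtain ⟨q, ρ, hq, hρ, hqp, hlim⟩ := hw
  have hqS : Filter.Tendsto q Filter.atTop (nhdsWithin p S) :=
    tendsto_nhdsWithin_iff.2 ⟨hqp, Filter.Eventually.of_forall hq⟩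
  have h1 : ∀ c > 0, ‖normalPart e w‖ ≤ c * ‖w‖ := by
    intro c hc
    refine le_of_tendsto_of_tendsto ((continuous_normalPart.tendsto w).comp hlim).norm
      (hlim.norm.const_mul c) ?_
    filter_upwards [hqS.eventually (hN c hc)] with i hi
    simp only [Function.comp_apply, normalPart_smul, norm_smul]
    calc ‖ρ i‖ * ‖normalPart e (q i - p)‖ ≤ ‖ρ i‖ * (c * ‖q i - p‖) := by gcongr
      _ = _ := by ring
  have h2 : normalPart e w = 0 := by
    rw [← norm_le_zero_iff]
    have h3 : Filter.Tendsto (fun c : ℝ => c * ‖w‖) (nhdsWithin 0 (Set.Ioi 0)) (nhds 0) := by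
      have : ContinuousAt (fun c : ℝ => c * ‖w‖) 0 := by fun_prop
      simpa using this.tendsto.mono_left nhdsWithin_le_nhds
    exact ge_of_tendsto h3 (by filter_upwards [self_mem_nhdsWithin] with c hc using h1 c hc)
  refine ⟨inner ℝ e w, height w, ?_, ?_⟩
  · refine ge_of_tendsto' ((continuous_height.tendsto w).comp hlim) fun i => ?_
    simp only [Function.comp_apply, height_smul, height_sub, hp0, sub_zero]
    exact mul_nonneg (hρ i).le (hS (hq i)).le
  · conv_lhs => rw [eq_add_normalPart e w, h2, add_zero]

/-- If no rescaled point of `S` came near the ray, the hyperplane `g = 0` would miss a punctured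
neighbourhood of `p` in `S ∪ Γ`. That contradicts connectedness, since `g` takes both signs on `Γ`
near `p`. -/
theorem mem_tanCone_of_normalPart (hS : S ⊆ upperHalf n) (hp : p ∈ Γ)
    (hΓ0 : Γ ⊆ idealBoundary n) (htop : IsTopSurfaceWithBoundary (S ∪ Γ))
    (hNΓ : ∀ c > 0, ∀ᶠ q in nhdsWithin p Γ, ‖normalPart e (q - p)‖ ≤ c * ‖q - p‖)
    (hN : ∀ c > 0, ∀ᶠ q in nhdsWithin p S, ‖normalPart e (q - p)‖ ≤ c * ‖q - p‖)
    (hpos : ∃ᶠ z in nhdsWithin p Γ, 0 < (inner ℝ e (z - p) : ℝ))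
    (hneg : ∃ᶠ z in nhdsWithin p Γ, (inner ℝ e (z - p) : ℝ) < 0) {s t : ℝ} (ht : 0 < t) :
    s • e + t • vertical n ∈ tanCone S p := by
  have hp0 : height p = 0 := hΓ0 hp
  set w := s • e + t • vertical n with hw
  rw [mem_tanCone_iff]
  intro ε hε
  by_contra! hno
  -- The bound `1 / 2` makes the in-plane part control the whole vector up to a factor 2. The other
  -- bound makes the rescaled normal error, at most `2 * c * ‖w‖`, smaller than `ε`.
  set c : ℝ := min (1 / 2) (ε / (4 * (‖w‖ + 1))) with hc
  have hc0 : 0 < c := by positivity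
  have hc1 : c ≤ 1 / 2 := min_le_left _ _
  have hc2 : 2 * c * ‖w‖ < ε := by
    have h1 : c ≤ ε / (4 * (‖w‖ + 1)) := min_le_right _ _
    rw [le_div_iff₀ (by positivity)] at h1
    nlinarith [norm_nonneg w]
  have hlow : ∀ z : Ambient n, ‖normalPart e z‖ ≤ c * ‖z‖ →
      ‖z‖ ≤ 2 * ‖(inner ℝ e z : ℝ) • e + height z • vertical n‖ := by
    intro z hz
    have h1 := norm_add_le ((inner ℝ e z : ℝ) • e + height z • vertical n) (normalPart e z)
    rw [← eq_add_normalPart] at h1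
    nlinarith [norm_nonneg z]
  have hO : ∀ᶠ q in nhds p, ‖q - p‖ < ε ∧
      (q ∈ S ∪ Γ → ‖normalPart e (q - p)‖ ≤ c * ‖q - p‖) := by
    have h1 := eventually_nhdsWithin_iff.1 (hNΓ c hc0)
    have h2 := eventually_nhdsWithin_iff.1 (hN c hc0)
    filter_upwards [h1, h2, Metric.ball_mem_nhds p hε] with q hq1 hq2 hq3
    exact ⟨mem_ball_iff_norm.1 hq3, fun h => h.elim hq2 hq1⟩
  -- Within the plane of `e` and the vertical, `g` vanishes exactly on the line through `p` in
  -- direction `w`. Positive height selects the correct ray of it.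
  set g : Ambient n → ℝ := fun q => t * inner ℝ e (q - p) - s * height (q - p) with hg
  have hgc : Continuous g := by
    have := continuous_height (n := n)
    fun_prop
  have hg0 : ∀ q ∈ S ∪ Γ, q ≠ p → ‖q - p‖ < ε → ‖normalPart e (q - p)‖ ≤ c * ‖q - p‖ →
      g q ≠ 0 := by
    intro q hq hqp hqε hqN h0
    have hl := hlow _ hqN
    rcases hq with hqS | hqΓ
    · have hy : 0 < height (q - p) := by rw [height_sub, hp0, sub_zero]; exact hS hqS
      set y := height (q - p) with hyd
      -- This scaling brings the height to `t`; together with `g = 0` it makes the in-plane part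
      -- exactly `w`.
      have hρ : 0 < t / y := by positivity
      have hi : (inner ℝ e (q - p) : ℝ) = s * y / t := by
        rw [eq_div_iff ht.ne']
        simp only [hg] at h0
        linarith
      have hpl : (t / y) • ((inner ℝ e (q - p) : ℝ) • e + y • vertical n) = w := by
        rw [hi, smul_add, smul_smul, smul_smul, hw]
        congr 2 <;> field_simp
      have h1 : (t / y) • (q - p) - w = (t / y) • normalPart e (q - p) := by
        have h2 := congrArg (fun z => (t / y) • z) (eq_add_normalPart e (q - p))
        simp only [smul_add _ (_ + _), ← hyd, hpl] at h2
        rw [h2, add_sub_cancel_left]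
      refine absurd (hno q hqS (t / y) hρ hqε) (not_le.2 ?_)
      rw [h1, norm_smul, Real.norm_of_nonneg hρ.le]
      have h2 : t / y * ‖(inner ℝ e (q - p) : ℝ) • e + y • vertical n‖ = ‖w‖ := by
        rw [← hpl, norm_smul, Real.norm_of_nonneg hρ.le]
      calc t / y * ‖normalPart e (q - p)‖ ≤ t / y * (c * (2 *
            ‖(inner ℝ e (q - p) : ℝ) • e + y • vertical n‖)) := by
            gcongr
            exact hqN.trans (by gcongr)
        _ = 2 * c * (t / y * ‖(inner ℝ e (q - p) : ℝ) • e + y • vertical n‖) := by ring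
        _ < ε := by rw [h2]; exact hc2
    · have hy : height (q - p) = 0 := by
        have : height q = 0 := hΓ0 hqΓ
        rw [height_sub, hp0, this, sub_zero]
      have hi : (inner ℝ e (q - p) : ℝ) = 0 := by
        simp only [hg, hy, mul_zero, sub_zero] at h0
        exact (mul_eq_zero.1 h0).resolve_left ht.ne'
      rw [hi, hy] at hl
      have h3 : ‖q - p‖ ≤ 0 := by simpa using hl
      exact hqp (sub_eq_zero.1 (norm_le_zero_iff.1 h3))
  obtain ⟨V, hV, hVO, hconn⟩ :=
    htop.exists_isPreconnected_diff_singleton (Or.inr hp) hO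
  have hVΓ : ∀ᶠ z in nhdsWithin p Γ, z ∈ V ∩ Γ :=
    Filter.inter_mem (nhdsWithin_mono p Set.subset_union_right hV) self_mem_nhdsWithin
  have hgΓ : ∀ z ∈ Γ, g z = t * inner ℝ e (z - p) := by
    intro z hz
    have : height z = 0 := hΓ0 hz
    simp only [hg, height_sub, hp0, this]
    ring
  have hne : ∀ z : Ambient n, (inner ℝ e (z - p) : ℝ) ≠ 0 → z ∉ ({p} : Set (Ambient n)) := by
    rintro z hz rfl
    simp at hz
  obtain ⟨z₁, hz₁, hz₁V, hz₁Γ⟩ := (hpos.and_eventually hVΓ).exists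
  obtain ⟨z₂, hz₂, hz₂V, hz₂Γ⟩ := (hneg.and_eventually hVΓ).exists
  obtain ⟨q, hq, hgq⟩ := hconn.intermediate_value₂ (f := g) (g := fun _ => 0)
    ⟨hz₂V, hne z₂ hz₂.ne⟩ ⟨hz₁V, hne z₁ hz₁.ne'⟩ hgc.continuousOn continuousOn_const
    (by rw [hgΓ z₂ hz₂Γ]; exact (mul_neg_of_pos_of_neg ht hz₂).le)
    (by rw [hgΓ z₁ hz₁Γ]; exact (mul_pos ht hz₁).le)
  obtain ⟨⟨hq1, hq2⟩, hq3⟩ := hVO hq.1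
  exact hg0 q hq3 hq.2 hq1 (hq2 hq3) hgq

/-- The tangent cone is closed, so it contains the boundary of the half-plane it nearly fills. -/
theorem mem_tanCone_of_forall_pos
    (h : ∀ s t : ℝ, 0 < t → s • e + t • vertical n ∈ tanCone S p) {s t : ℝ} (ht : 0 ≤ t) :
    s • e + t • vertical n ∈ tanCone S p := by
  rw [mem_tanCone_iff]
  intro ε hε
  obtain ⟨q, hq, ρ, hρ, hqp, hw⟩ :=
    mem_tanCone_iff.1 (h s (t + ε / 2) (by positivity)) (ε / 2) (by positivity)
  refine ⟨q, hq, ρ, hρ, by linarith, ?_⟩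
  have h1 : ρ • (q - p) - (s • e + t • vertical n)
      = (ρ • (q - p) - (s • e + (t + ε / 2) • vertical n)) + (ε / 2) • vertical n := by
    rw [add_smul]
    abel
  rw [h1]
  refine (norm_add_le _ _).trans_lt ?_
  rw [norm_smul, norm_vertical, Real.norm_of_nonneg (by positivity)]
  linarith

end cone

/-! ### Assembly of the two inclusions. -/

/-- The tangent cone in terms of a local parametrization of the ideal boundary curve. -/
theorem IsLocalParam.mem_tanCone_iff {n : ℕ} {S Γ : Set (Ambient n)}
    {U : Set (EuclideanSpace ℝ (Fin 1))} {F : EuclideanSpace ℝ (Fin 1) → Ambient n}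
    (hF : IsLocalParam 1 Γ U F) {u : EuclideanSpace ℝ (Fin 1)} (hu : u ∈ U)
    (hS : IsMinimalSurface S) (hΓ0 : Γ ⊆ idealBoundary n)
    (htop : IsTopSurfaceWithBoundary (S ∪ Γ)) (w : Ambient n) :
    w ∈ tanCone S (F u) ↔
      ∃ v ∈ Set.range (fderiv ℝ F u), ∃ t : ℝ, 0 ≤ t ∧ w = v + t • vertical n := by
  obtain ⟨e, he, he0, hrange, hpos, hneg⟩ := hF.exists_unit_tangent hu hΓ0
  have hp : F u ∈ Γ := hF.mapsTo hu
  have hdF : ∀ h, normalPart e (fderiv ℝ F u h) = 0 := by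
    intro h
    obtain ⟨s, hs⟩ := (hrange _).1 ⟨h, rfl⟩
    rw [hs, normalPart_smul, normalPart_self he he0, smul_zero]
  have hNΓ : ∀ c > 0, ∀ᶠ z in nhdsWithin (F u) Γ, ‖normalPart e (z - F u)‖ ≤ c * ‖z - F u‖ :=
    fun c hc => hF.eventually_norm_normalPart_le hu he he0 hdF hc
  obtain ⟨K, hKS, hK, hKp⟩ := htop.exists_isCompact (Or.inr hp)
  have hN : ∀ c > 0, ∀ᶠ q in nhdsWithin (F u) S, ‖normalPart e (q - F u)‖ ≤ c * ‖q - F u‖ :=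
    fun c hc => hS.eventually_norm_normalPart_le (hΓ0 hp) he he0 hK hKS hKp hNΓ hc
  constructor
  · intro hw
    obtain ⟨s, t, ht, rfl⟩ := tanCone_subset_of_normalPart hS.1 (hΓ0 hp) hN hw
    exact ⟨s • e, (hrange _).2 ⟨s, rfl⟩, t, ht, rfl⟩
  · rintro ⟨v, hv, t, ht, rfl⟩
    obtain ⟨s, rfl⟩ := (hrange v).1 hv
    exact mem_tanCone_of_forall_pos (fun s t ht =>
      mem_tanCone_of_normalPart hS.1 hp hΓ0 htop hNΓ hN hpos hneg ht) ht

theorem mainTheorem5 (n : ℕ) (S Γ : Set (Ambient n))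
    (hS : IsMinimalSurface S) (hΓ : IsSubmanifold 1 1 Γ) (hSΓ : IsAsymptoticTo S Γ)
    (htop : IsTopSurfaceWithBoundary (S ∪ Γ)) :
    ∀ p ∈ Γ, tanCone S p =
      {w | ∃ v ∈ tangentSpaceAt 1 Γ p, ∃ t : ℝ, 0 ≤ t ∧ w = v + t • vertical n} := by
  have hΓ0 : Γ ⊆ idealBoundary n := hSΓ.symm.subset.trans Set.inter_subset_right
  intro p hp
  ext w
  constructor
  · intro hw
    obtain ⟨U, F, hF, u, hu, rfl⟩ := hΓ p hp
    obtain ⟨v, hv, t, ht, hwv⟩ := (hF.mem_tanCone_iff hu hS hΓ0 htop w).1 hw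
    exact ⟨v, ⟨U, F, hF, u, hu, rfl, hv⟩, t, ht, hwv⟩
  -- The description of the cone holds for every local parametrization, so the one supplied by
  -- `tangentSpaceAt` needs no comparison with another.
  · rintro ⟨v, ⟨U, F, hF, u, hu, rfl, hv⟩, t, ht, hwv⟩
    exact (hF.mem_tanCone_iff hu hS hΓ0 htop w).2 ⟨v, hv, t, ht, hwv⟩
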